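/- Let $(X_k)_{k\ge 0}$ be a Markov chain on a measurable space $\mathcal X$ with initial law $m_0$ and transition kernel $q(dx'\mid x)$, and let $G_k:\mathcal X\to[0,\infty)$, $k\ge 0$, be measurable potentials. Fix $n\ge 1$, suppose that $\mathcal Z_n=\mathbb E\big[\prod_{k=0}^n G_k(X_k)\big]>0$, and let $$\pi_n(dx_{0:n})=\mathcal Z_n^{-1}\,m_0(dx_0)\prod_{k=1}^{n}q(dx_k\mid x_{k-1})\prod_{k=0}^{n}G_k(x_k).$$ For $0\le k<n$ write $p_{k+1:n}(x_k)=\int\prod_{j=k+1}^n q(dx_j\mid x_{j-1})\,G_j(x_j)$. For $N\ge 1$ and a reference path $\bar x_{0:n}\in\mathcal X^{n+1}$, the conditional SMC kernel $P_n^N(\bar x_{0:n},\cdot)$ is the law of the path produced as follows. Put $X_k^0=\bar x_k$ for all $k$. Draw $X_0^1,\dots,X_0^N$ independently from $m_0$. For $k=1,\dots,n$, given the past, draw independently for $i=1,\dots,N$ an ancestor label $A_{k-1}^i\in\{0,\dots,N\}$ with probabilities $G_{k-1}(X_{k-1}^j)/\sum_{l=0}^N G_{k-1}(X_{k-1}^l)$,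 $0\le j\le N$, and then $X_k^i\sim q(\cdot\mid X_{k-1}^{A_{k-1}^i})$; put $A_{k-1}^0=0$. Finally draw $N^*\in\{0,\dots,N\}$ with probabilities $G_n(X_n^j)/\sum_{l=0}^N G_n(X_n^l)$ and return $(X_k^{B_k})_{0\le k\le n}$, where $B_n=N^*$ and $B_k=A_k^{B_{k+1}}$ for $k<n$. (Where all the weights of a draw vanish, label $0$ is drawn.) Assume that (A1) there is $\underline g>0$ such that $\underline g\le p_{k+1:n}(x)/p_{k+1:n}(x')\le\underline g^{-1}$ for all $0\le k<n$ and $x,x'\in\mathcal X$ (in particular $p_{k+1:n}$ does not vanish); (A2) there is $a$ such that $G_k(x)\le a$ for all $0\le k\le n$ and $x\in\mathcal X$. Then there is $c>0$ such that $$\int G_0\,dm_0>c^{-1}\quad\text{and}\quad \int q(dx'\mid x)\,G_k(x')>c^{-1}\ \text{ for all }1\le k\le n,\ x\in\mathcal X,$$ and for every such $c$, every $N\ge 1$, every reference path $\bar x_{0:n}$ and every measurable $f_n:\mathcal X^{n+1}\to\mathbb R$ with $\|f_n\|_\infty\le 1$, $$\left|P_n^N(f_n)(\bar x_{0:n})-\pi_n(f_n)\right|\le\frac{2(n+1)\,a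 c\,\underline g^{-1}-1}{N-1+2ac\,\underline g^{-1}}+\frac{n\,(ac\,\underline g^{-1})^2}{N}.$$ In particular the error is $O(n/N)$: it is at most $\big(4ac\,\underline g^{-1}+(ac\,\underline g^{-1})^2\big)\,n/N$. -/

import Mathlib

open MeasureTheory ProbabilityTheory
open scoped NNReal ENNReal

namespace CSMC

/-! ### Independent draws and selection -/

/-- Independent draws with laws `κ i a`, `i : ι`, as a kernel. -/
noncomputable def piKernel {ι α β : Type*} [Fintype ι] [MeasurableSpace α] [MeasurableSpace β]
    (κ : ι → Kernel α β) [∀ i, IsMarkovKernel (κ i)] : Kernel α (ι → β) where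
  toFun a := Measure.pi fun i => κ i a
  measurable' := by
    refine Measurable.measure_of_isPiSystem_of_isProbabilityMeasure
      generateFrom_pi.symm isPiSystem_pi ?_
    rintro _ ⟨t, ht, rfl⟩
    simp only [Measure.pi_pi]
    exact Finset.measurable_prod _ fun i _ =>
      (κ i).measurable_coe (ht i (Set.mem_univ i))

instance {ι α β : Type*} [Fintype ι] [MeasurableSpace α] [MeasurableSpace β]
    (κ : ι → Kernel α β) [∀ i, IsMarkovKernel (κ i)] : IsMarkovKernel (piKernel κ) :=
  ⟨fun a => by
    change IsProbabilityMeasure (Measure.pi fun i => κ i a)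
    infer_instance⟩

/-- A state space model: initial law `m₀ (dx)`, transition kernel `q (dx' | x)` and nonnegative
measurable potentials `G_k`. -/
structure Model (X : Type*) [MeasurableSpace X] where
  /-- the initial law -/
  m₀ : Measure X
  /-- the transition kernel -/
  q : Kernel X X
  /-- the potentials -/
  G : ℕ → X → ℝ≥0
  isProb_m₀ : IsProbabilityMeasure m₀
  isMarkov_q : IsMarkovKernel q
  measurable_G : ∀ k, Measurable (G k)

attribute [instance] Model.isProb_m₀ Model.isMarkov_q

variable {X : Type*} [MeasurableSpace X]

/-- The measure on the labels `0, …, N` that gives label `j` the normalised weight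
`g (y j) / ∑ l, g (y l)`. If all the weights vanish, where these are not defined, the label
`0` is selected. -/
noncomputable def selectMeasure (N : ℕ) (g : X → ℝ≥0) (y : Fin (N + 1) → X) :
    Measure (Fin (N + 1)) :=
  if ∑ l, g (y l) = 0 then Measure.dirac 0
  else ∑ j, ((g (y j) / ∑ l, g (y l) : ℝ≥0) : ℝ≥0∞) • Measure.dirac j

namespace Model

variable (M : Model X)

/-- Selection of one label among `N + 1` points at time `k`. -/
noncomputable def select (N k : ℕ) : Kernel (Fin (N + 1) → X) (Fin (N + 1)) where
  toFun := selectMeasure N (M.G k)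
  measurable' := by
    have hG := M.measurable_G k
    have hs : Measurable fun y : Fin (N + 1) → X => ∑ l, M.G k (y l) :=
      Finset.measurable_sum _ fun l _ => hG.comp (measurable_pi_apply l)
    unfold selectMeasure
    refine Measurable.ite (hs (measurableSet_singleton 0)) measurable_const ?_
    refine Measure.measurable_of_measurable_coe _ fun s _ => ?_
    simp only [Measure.coe_finsetSum, Finset.sum_apply, Measure.smul_apply, smul_eq_mul]
    exact Finset.measurable_sum _ fun j _ =>
      (((hG.comp (measurable_pi_apply j)).div hs).coe_nnreal_ennreal).mul_const _

instance (N k : ℕ) : IsMarkovKernel (M.select N k) := ⟨fun y => by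
  change IsProbabilityMeasure (selectMeasure N (M.G k) y)
  unfold selectMeasure
  split_ifs with h
  · infer_instance
  · constructor
    simp only [Measure.coe_finsetSum, Finset.sum_apply, Measure.smul_apply, smul_eq_mul,
      measure_univ, mul_one]
    rw [← ENNReal.ofNNReal_finsetSum, ← Finset.sum_div, div_self h, ENNReal.coe_one]⟩

/-- Given the points `y 0, …, y N` and the ancestor labels `A 1, …, A N`, draw independently
the new particles `X i ∼ q (· | y (A i))`. -/
noncomputable def propagate (N : ℕ) :
    Kernel ((Fin (N + 1) → X) × (Fin N → Fin (N + 1))) (Fin N → X) :=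
  piKernel fun i => M.q.comap (fun p => p.1 (p.2 i))
    (measurable_from_prod_countable_left fun A => measurable_pi_apply (A i))

instance (N : ℕ) : IsMarkovKernel (M.propagate N) := by unfold propagate; infer_instance

/-- One step of the particle system at time `k`: given the points `y 0, …, y N` at time `k`,
select independently `N` ancestor labels, then propagate. -/
noncomputable def step (N k : ℕ) :
    Kernel (Fin (N + 1) → X) ((Fin N → Fin (N + 1)) × (Fin N → X)) :=
  (piKernel fun _ => M.select N k) ⊗ₖ M.propagate N

instance (N k : ℕ) : IsMarkovKernel (M.step N k) := by unfold step; infer_instance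

end Model

/-! ### The particle system conditioned on a reference path -/

/-- The particles `X_k^i`, `0 ≤ k ≤ n`, and the ancestor labels `A_k^i`, `0 ≤ k < n`. The
particle called `i` in the mathematics, `1 ≤ i ≤ N`, is here `i - 1 : Fin N`; among the `N + 1`
labels `Fin (N + 1)`, the label `0` is the reference path and `i.succ` is the particle `i`. -/
abbrev History (X : Type*) (N n : ℕ) : Type _ :=
  (Fin (n + 1) → Fin N → X) × (Fin n → Fin N → Fin (N + 1))

/-- All the points at time `k`, the point `xbar k` of the reference path being number `0`. -/
def points {N n : ℕ} (xbar : Fin (n + 1) → X) (h : History X N n) (k : Fin (n + 1)) :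
    Fin (N + 1) → X :=
  Fin.cons (xbar k) (h.1 k)

/-- Append the ancestor labels and the particles of one more step. -/
def extend {N n : ℕ} (h : History X N n) (s : (Fin N → Fin (N + 1)) × (Fin N → X)) :
    History X N (n + 1) :=
  (Fin.snoc h.1 s.2, Fin.snoc h.2 s.1)

theorem measurable_points {N n : ℕ} (k : Fin (n + 1)) :
    Measurable fun p : (Fin (n + 1) → X) × History X N n => points p.1 p.2 k := by
  refine measurable_pi_iff.2 fun j => ?_
  refine Fin.cases ?_ (fun i => ?_) j
  · simp only [points, Fin.cons_zero]; fun_prop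
  · simp only [points, Fin.cons_succ]; fun_prop

theorem measurable_snoc {Y : Type*} [MeasurableSpace Y] {n : ℕ} :
    Measurable fun p : (Fin n → Y) × Y => (Fin.snoc p.1 p.2 : Fin (n + 1) → Y) := by
  refine measurable_pi_iff.2 fun j => ?_
  refine Fin.lastCases ?_ (fun i => ?_) j
  · simp only [Fin.snoc_last]; fun_prop
  · simp only [Fin.snoc_castSucc]; fun_prop

theorem measurable_init {Y : Type*} [MeasurableSpace Y] {n : ℕ} :
    Measurable fun x : Fin (n + 1) → Y => (Fin.init x : Fin n → Y) :=
  measurable_pi_iff.2 fun k => measurable_pi_apply k.castSucc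

theorem measurable_extend {N n : ℕ} :
    Measurable fun p : History X N n × ((Fin N → Fin (N + 1)) × (Fin N → X)) =>
      extend p.1 p.2 :=
  (measurable_snoc.comp (by fun_prop :
    Measurable fun p : History X N n × ((Fin N → Fin (N + 1)) × (Fin N → X)) =>
      (p.1.1, p.2.2))).prodMk
  (measurable_snoc.comp (by fun_prop :
    Measurable fun p : History X N n × ((Fin N → Fin (N + 1)) × (Fin N → X)) =>
      (p.1.2, p.2.1)))

/-- The label `B_k` at time `k` of the ancestor of the particle with label `i` at time `n`:
`B_n = i` and `B_k = A_k^{B_{k+1}}`, the ancestor of label `0` (the reference path) being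
label `0`. -/
def lineage {N n : ℕ} (A : Fin n → Fin N → Fin (N + 1)) (i : Fin (N + 1)) (k : Fin (n + 1)) :
    Fin (N + 1) :=
  Fin.reverseInduction (motive := fun _ => Fin (N + 1)) i
    (fun k b => (Fin.cons 0 (A k) : Fin (N + 1) → Fin (N + 1)) b) k

/-- The path `(X_k^{B_k})_{0 ≤ k ≤ n}` that ends in the particle with label `i` at time `n`. -/
def outputPath {N n : ℕ} (xbar : Fin (n + 1) → X) (h : History X N n) (i : Fin (N + 1)) :
    Fin (n + 1) → X :=
  fun k => points xbar h k (lineage h.2 i k)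

theorem measurable_outputPath {N n : ℕ} :
    Measurable fun p : (Fin (n + 1) → X) × (History X N n × Fin (N + 1)) =>
      outputPath p.1 p.2.1 p.2.2 := by
  have h : Measurable fun p : ((Fin (n + 1) → X) × (Fin (n + 1) → Fin N → X)) ×
      ((Fin n → Fin N → Fin (N + 1)) × Fin (N + 1)) =>
      outputPath p.1.1 (p.1.2, p.2.1) p.2.2 := by
    refine measurable_from_prod_countable_left fun Ai => measurable_pi_iff.2 fun k => ?_
    have h2 : Measurable fun p : (Fin (n + 1) → X) × (Fin (n + 1) → Fin N → X) =>
        ((p.1, (p.2, Ai.1)) : (Fin (n + 1) → X) × History X N n) := by fun_prop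
    exact (measurable_pi_apply (lineage Ai.1 Ai.2 k)).comp ((measurable_points k).comp h2)
  exact h.comp (by fun_prop :
    Measurable fun p : (Fin (n + 1) → X) × (History X N n × Fin (N + 1)) =>
      ((p.1, p.2.1.1), (p.2.1.2, p.2.2)))

namespace Model

variable (M : Model X)

/-- The law of the conditional particle system with `N` free particles up to time `n`, as a
kernel of the reference path `xbar`. -/
noncomputable def particles (N : ℕ) : (n : ℕ) → Kernel (Fin (n + 1) → X) (History X N n)
  | 0 => Kernel.const _
      ((Measure.pi fun _ : Fin N => M.m₀).map fun x => ((fun _ => x, Fin.elim0) : History X N 0))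
  | n + 1 =>
      (((particles N n).comap (fun xbar : Fin (n + 2) → X => Fin.init xbar)
          measurable_init) ⊗ₖ
        ((M.step N n).comap
          (fun p : (Fin (n + 2) → X) × History X N n =>
            points (Fin.init p.1) p.2 (Fin.last n))
          ((measurable_points (Fin.last n)).comp
            ((measurable_init.comp measurable_fst).prodMk measurable_snd)))).map
      fun p => extend p.1 p.2

instance (N n : ℕ) : IsMarkovKernel (M.particles N n) := by
  induction n with
  | zero =>
    have : IsProbabilityMeasure ((Measure.pi fun _ : Fin N => M.m₀).map
        fun x => ((fun _ => x, Fin.elim0) : History X N 0)) :=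
      Measure.isProbabilityMeasure_map (by fun_prop)
    unfold particles
    infer_instance
  | succ n ih =>
    unfold particles
    exact Kernel.IsMarkovKernel.map _ measurable_extend

/-- The conditional SMC kernel `P^N_n (xbar, dx)` on the path space: run the conditional
particle system, select a final label with weights `G_n`, return the path that ends there. -/
noncomputable def csmc (N n : ℕ) : Kernel (Fin (n + 1) → X) (Fin (n + 1) → X) :=
  (Kernel.id ×ₖ (M.particles N n ⊗ₖ
    (M.select N n).comap
      (fun p : (Fin (n + 1) → X) × History X N n => points p.1 p.2 (Fin.last n))
      (measurable_points (Fin.last n)))).map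
    fun p => outputPath p.1 p.2.1 p.2.2

instance (N n : ℕ) : IsMarkovKernel (M.csmc N n) := by
  unfold csmc
  exact Kernel.IsMarkovKernel.map _ measurable_outputPath

/-! ### The target distribution -/

/-- The law of the Markov chain `(X_0, …, X_n)`. -/
noncomputable def pathLaw : (n : ℕ) → Measure (Fin (n + 1) → X)
  | 0 => M.m₀.map fun x _ => x
  | n + 1 => (pathLaw n ⊗ₘ M.q.comap (fun x : Fin (n + 1) → X => x (Fin.last n))
      (measurable_pi_apply _)).map fun p => Fin.snoc p.1 p.2

instance (n : ℕ) : IsProbabilityMeasure (M.pathLaw n) := by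
  induction n with
  | zero =>
    unfold pathLaw
    exact Measure.isProbabilityMeasure_map (by fun_prop)
  | succ n ih =>
    unfold pathLaw
    exact Measure.isProbabilityMeasure_map measurable_snoc.aemeasurable

/-- The product `G_0 (x_0) ⋯ G_n (x_n)`. -/
noncomputable def weight (n : ℕ) (x : Fin (n + 1) → X) : ℝ≥0∞ :=
  ∏ i : Fin (n + 1), (M.G i (x i) : ℝ≥0∞)

/-- The normalising constant of the target distribution. -/
noncomputable def normConst (n : ℕ) : ℝ≥0∞ := ∫⁻ x, M.weight n x ∂M.pathLaw n

/-- The target distribution `π_n` on the path space. -/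
noncomputable def target (n : ℕ) : Measure (Fin (n + 1) → X) :=
  (M.normConst n)⁻¹ • (M.pathLaw n).withDensity (M.weight n)

/-! ### The assumptions -/

/-- `M.futureLik m k x` is `∫ ∏_{j=k+1}^{k+m} q (dx_j | x_{j-1}) G_j (x_j)` with `x_k = x`. -/
noncomputable def futureLik : ℕ → ℕ → X → ℝ
  | 0, _, _ => 1
  | m + 1, k, x => ∫ x', (M.G (k + 1) x' : ℝ) * futureLik m (k + 1) x' ∂M.q x

/-- The function `p_{k+1:n}` of `x_k`, for `k < n`: the likelihood of the observations at the
times `k + 1, …, n`. -/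
noncomputable def obsLik (k n : ℕ) (x : X) : ℝ := M.futureLik (n - k) k x

/-- For all `k < n` the ratios `p_{k+1:n} (x) / p_{k+1:n} (x')` lie between `g` and `g⁻¹`.
As `0 < g`, the case `x = x'` says that `p_{k+1:n} (x)` is not zero. -/
def BoundedRatio (n : ℕ) (g : ℝ) : Prop :=
  0 < g ∧ ∀ k < n, ∀ x x' : X,
    g ≤ M.obsLik k n x / M.obsLik k n x' ∧ M.obsLik k n x / M.obsLik k n x' ≤ g⁻¹

/-- The potentials up to time `n` are bounded by `a`. -/
def BoundedPotentials (n : ℕ) (a : ℝ) : Prop := ∀ k ≤ n, ∀ x, (M.G k x : ℝ) ≤ a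

/-- The expected potential of the next state is more than `c⁻¹`, from the initial law and from
every state, at all times up to `n`. -/
def PotentialLowerBound (n : ℕ) (c : ℝ) : Prop :=
  0 < c ∧ c⁻¹ < ∫ x, (M.G 0 x : ℝ) ∂M.m₀ ∧
    ∀ k, 1 ≤ k → k ≤ n → ∀ x, c⁻¹ < ∫ x', (M.G k x' : ℝ) ∂M.q x

end Model

end CSMC

open MeasureTheory ProbabilityTheory
open scoped NNReal ENNReal

namespace CSMC

/-! Set `H_k = G_k · p_{k+1:n}`, so that `H_n = G_n` and `H_k = G_k · q H_{k+1}`. Under the two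
assumptions each `H_k` is at most `α = a c g⁻¹` times its mean under `m₀` (for `k = 0`) or under `q
(· | x)` (for `k ≥ 1`), uniformly in `x`.

The static estimate is `abs_integral_weightedMean_sub_le`. Take `N` i.i.d. draws from `μ` and one
reference point, and select with weights `H`. If the reference were itself drawn from the law with
density proportional to `H`, selection would be exactly unbiased for that law, by exchangeability
(`integral_mul_weightedMean`). Exchanging a random reference for a fixed one moves the weighted mean
by at most `2 A / (A + ∑ H)`, where `A` bounds `H`. Averaged under the tilted law this costs at most
`2 α / (N + 1)`, since one of `N + 1` exchangeable points has expected normalised weight at most `1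
/ (N + 1)`.

Given the past, the pairs (ancestor label, new particle) are i.i.d., so the static estimate applies
to each step (`abs_integral_step_sub_le`). Up to `2 α / (N + 1)`, selecting at time `k + 1` with
weights `H_{k+1}` amounts to selecting at time `k` with weights `H_k`, with the test function
averaged over its last coordinate. Going back from `n` to the initial draw, the errors add up
without amplification (`IsBackward.abs_terminalMean_sub_le`), to `2 (n + 1) α / (N + 1)`. As `α ≥
1`, elementary algebra weakens this to both stated bounds. -/

/-! ### Selection among a reference point and i.i.d. draws -/

/-- The weighted mean of `F 0, …, F N` with weights `v`, which is `F 0` if the weights add up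
to zero. -/
noncomputable def weightedMean {N : ℕ} (v F : Fin (N + 1) → ℝ) : ℝ :=
  if ∑ l, v l = 0 then F 0 else (∑ l, v l * F l) / ∑ l, v l

theorem abs_sum_mul_le {N : ℕ} {v F : Fin N → ℝ} (hv : ∀ l, 0 ≤ v l) (hF : ∀ l, |F l| ≤ 1) :
    |∑ l, v l * F l| ≤ ∑ l, v l := by
  refine (Finset.abs_sum_le_sum_abs _ _).trans (Finset.sum_le_sum fun l _ => ?_)
  rw [abs_mul, abs_of_nonneg (hv l)]
  exact mul_le_of_le_one_right (hv l) (hF l)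

theorem abs_weightedMean_le {N : ℕ} {v F : Fin (N + 1) → ℝ} (hv : ∀ l, 0 ≤ v l)
    (hF : ∀ l, |F l| ≤ 1) : |weightedMean v F| ≤ 1 := by
  unfold weightedMean
  split_ifs with h
  · exact hF 0
  · have hs : 0 < ∑ l, v l := lt_of_le_of_ne (Finset.sum_nonneg fun l _ => hv l) (Ne.symm h)
    rw [abs_div, abs_of_pos hs, div_le_one hs]
    exact abs_sum_mul_le hv hF

theorem measurable_weightedMean {Z : Type*} [MeasurableSpace Z] {N : ℕ}
    {v F : Z → Fin (N + 1) → ℝ} (hv : Measurable v) (hF : Measurable F) :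
    Measurable fun z => weightedMean (v z) (F z) := by
  have hs : Measurable fun z => ∑ l, v z l := by fun_prop
  exact Measurable.ite (hs (measurableSet_singleton 0)) (by fun_prop) (by fun_prop)

/-- Replacing the reference point changes the weighted mean by at most twice the largest weight
that a reference point may have. -/
theorem abs_weightedMean_cons_sub_le {N : ℕ} {v F : Fin N → ℝ} {u u' b b' A : ℝ} (hA : 0 < A)
    (hv : ∀ l, 0 ≤ v l) (hF : ∀ l, |F l| ≤ 1) (hu : 0 ≤ u) (huA : u ≤ A) (hu' : 0 ≤ u')
    (huA' : u' ≤ A) (hb : |b| ≤ 1) (hb' : |b'| ≤ 1) :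
    |weightedMean (Fin.cons u v : Fin (N + 1) → ℝ) (Fin.cons b F) -
      weightedMean (Fin.cons u' v : Fin (N + 1) → ℝ) (Fin.cons b' F)| ≤
      2 * A / (A + ∑ l, v l) := by
  have hs : 0 ≤ ∑ l, v l := Finset.sum_nonneg fun l _ => hv l
  have hr := abs_sum_mul_le hv hF
  simp only [weightedMean, Fin.sum_univ_succ, Fin.cons_zero, Fin.cons_succ]
  generalize ∑ l, v l = s at *
  generalize ∑ l, v l * F l = r at *
  rw [abs_le] at hb hb' hr
  -- If the other weights vanish, the bound is `2`, which holds for any two means in `[-1, 1]`.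
  rcases hs.eq_or_lt with rfl | hs
  · obtain rfl : r = 0 := by linarith
    simp only [add_zero]
    rw [mul_div_cancel_right₀ _ hA.ne']
    have key : ∀ w d : ℝ, |d| ≤ 1 → |if w = 0 then d else w * d / w| ≤ 1 := by
      intro w d hd
      split_ifs with h
      · exact hd
      · rwa [mul_div_cancel_left₀ _ h]
    have h1 := abs_le.1 (key u b (abs_le.2 hb))
    have h2 := abs_le.1 (key u' b' (abs_le.2 hb'))
    rw [abs_le]
    constructor <;> linarith
  · have key : ∀ u u' b b' : ℝ, 0 ≤ u → u ≤ A → 0 ≤ u' → u' ≤ A → -1 ≤ b → b ≤ 1 → -1 ≤ b' →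
        b' ≤ 1 → (u * b + r) / (u + s) - (u' * b' + r) / (u' + s) ≤ 2 * A / (A + s) := by
      intro u u' b b' hu huA hu' huA' hb1 hb2 hb1' hb2'
      -- With `ρ = r / s` the mean over the other points, the reference shifts it by `θ (d - ρ)`,
      -- where `θ ≤ T = A / (A + s)`. The difference of two shifts is at most `T (1 - ρ) + T (1 + ρ)
      -- = 2 T`.
      have e : ∀ w d : ℝ, 0 ≤ w → (w * d + r) / (w + s) = r / s + w / (w + s) * (d - r / s) := by
        intro w d hw
        have : w + s ≠ 0 := by positivity
        field_simp
        ring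
      have t : ∀ w : ℝ, 0 ≤ w → w ≤ A → w / (w + s) ≤ A / (A + s) := by
        intro w hw hwA
        rw [div_le_div_iff₀ (by positivity) (by positivity)]
        nlinarith
      have ρ1 : -1 ≤ r / s := by rw [le_div_iff₀ hs]; linarith
      have ρ2 : r / s ≤ 1 := by rw [div_le_iff₀ hs]; linarith
      rw [e u b hu, e u' b' hu', mul_div_assoc]
      have t1 := t u hu huA
      have t2 := t u' hu' huA'
      have p1 : 0 ≤ u / (u + s) := by positivity
      have p2 : 0 ≤ u' / (u' + s) := by positivity
      generalize u / (u + s) = θ at *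
      generalize u' / (u' + s) = θ' at *
      generalize r / s = ρ at *
      generalize A / (A + s) = T at *
      nlinarith [mul_le_mul_of_nonneg_left (show b - ρ ≤ 1 - ρ by linarith) p1,
        mul_le_mul_of_nonneg_left (show -1 - ρ ≤ b' - ρ by linarith) p2,
        mul_nonneg (sub_nonneg.2 t1) (show 0 ≤ 1 - ρ by linarith),
        mul_nonneg (sub_nonneg.2 t2) (show 0 ≤ 1 + ρ by linarith)]
    rw [if_neg (by positivity), if_neg (by positivity), abs_le]
    constructor
    · linarith [key u' u b' b hu' huA' hu huA hb'.1 hb'.2 hb.1 hb.2]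
    · exact key u u' b b' hu huA hu' huA' hb.1 hb.2 hb'.1 hb'.2

section Selection

variable {Y : Type*} [MeasurableSpace Y] (μ : Measure Y) [IsProbabilityMeasure μ]

/-- Under independent identically distributed draws the coordinates are exchangeable. -/
theorem integral_pi_comp_swap {N : ℕ} (φ : (Fin (N + 1) → Y) → ℝ) (i : Fin (N + 1)) :
    ∫ y, φ (y ∘ Equiv.swap 0 i) ∂Measure.pi (fun _ : Fin (N + 1) => μ) =
      ∫ y, φ y ∂Measure.pi (fun _ : Fin (N + 1) => μ) := by
  have h := measurePreserving_piCongrLeft (fun _ : Fin (N + 1) => μ) (Equiv.swap 0 i)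
  rw [← h.integral_comp' φ]
  refine integral_congr_ae (ae_of_all _ fun y => ?_)
  refine congrArg φ (funext fun j => ?_)
  have := Equiv.piCongrLeft_apply_apply (fun _ => Y) (Equiv.swap 0 i) y (Equiv.swap 0 i j)
  rw [Equiv.swap_apply_self] at this
  exact this.symm

theorem integral_pi_eval {N : ℕ} (i : Fin (N + 1)) {φ : Y → ℝ} (hφ : Measurable φ) :
    ∫ y, φ (y i) ∂Measure.pi (fun _ : Fin (N + 1) => μ) = ∫ x, φ x ∂μ := by
  have h := measurePreserving_eval (fun _ : Fin (N + 1) => μ) i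
  have e := integral_map (μ := Measure.pi fun _ : Fin (N + 1) => μ) h.measurable.aemeasurable
    (f := φ) hφ.aestronglyMeasurable
  rw [h.map_eq] at e
  exact e.symm

theorem integral_pi_cons {N : ℕ} {φ : (Fin (N + 1) → Y) → ℝ} :
    ∫ y, φ y ∂Measure.pi (fun _ : Fin (N + 1) => μ) =
      ∫ p : Y × (Fin N → Y), φ (Fin.cons p.1 p.2)
        ∂μ.prod (Measure.pi fun _ : Fin N => μ) := by
  have h := measurePreserving_piFinSuccAbove (fun _ : Fin (N + 1) => μ) 0
  rw [← h.integral_comp' (fun p : Y × (Fin N → Y) => φ (Fin.cons p.1 p.2))]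
  refine integral_congr_ae (ae_of_all _ fun y => ?_)
  congr 1
  exact (Fin.cons_self_tail y).symm

variable {μ} {H f : Y → ℝ}

/-- Selection with weights `H` is unbiased for the law with density `H`, if the reference point
is drawn from that law. -/
theorem integral_mul_weightedMean {N : ℕ} {C : ℝ} (hH : Measurable H) (hf : Measurable f)
    (h0 : ∀ y, 0 ≤ H y) (hC : ∀ y, H y ≤ C) (hf1 : ∀ y, |f y| ≤ 1) :
    ∫ y, H (y 0) * weightedMean (fun l => H (y l)) (fun l => f (y l))
      ∂Measure.pi (fun _ : Fin (N + 1) => μ) = ∫ x, H x * f x ∂μ := by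
  set P := Measure.pi (fun _ : Fin (N + 1) => μ)
  -- Unlike `weightedMean`, whose default singles out label `0`, `R` is invariant under permutations
  -- of the points. The two agree after multiplication by any `H (y i)`, which is zero in the
  -- degenerate case.
  set R : (Fin (N + 1) → Y) → ℝ := fun y => (∑ l, H (y l) * f (y l)) / ∑ l, H (y l)
  have hR : Measurable R := by fun_prop
  have h1 : ∀ y : Fin (N + 1) → Y, ∀ i, H (y i) * R y =
      H (y i) * weightedMean (fun l => H (y l)) (fun l => f (y l)) := by
    intro y i
    unfold weightedMean
    split_ifs with h
    · rw [(Finset.sum_eq_zero_iff_of_nonneg fun l _ => h0 (y l)).1 h i (Finset.mem_univ i)]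
      simp
    · rfl
  have hint : ∀ i, Integrable (fun y : Fin (N + 1) → Y => H (y i) * R y) P := by
    intro i
    refine Integrable.of_bound (by fun_prop) C (ae_of_all _ fun y => ?_)
    rw [h1, Real.norm_eq_abs, abs_mul, abs_of_nonneg (h0 _)]
    exact (mul_le_of_le_one_right (h0 _)
      (abs_weightedMean_le (fun l => h0 _) fun l => hf1 _)).trans (hC _)
  have hswap : ∀ i, ∫ y, H (y i) * R y ∂P = ∫ y, H (y 0) * R y ∂P := by
    intro i
    rw [← integral_pi_comp_swap μ (fun y => H (y 0) * R y) i]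
    refine integral_congr_ae (ae_of_all _ fun y => ?_)
    simp only [R, Function.comp, Equiv.swap_apply_left]
    rw [Equiv.sum_comp (Equiv.swap 0 i) fun l => H (y l) * f (y l),
      Equiv.sum_comp (Equiv.swap 0 i) fun l => H (y l)]
  have hfi : ∀ i, Integrable (fun y : Fin (N + 1) → Y => H (y i) * f (y i)) P := by
    intro i
    refine Integrable.of_bound (by fun_prop) C (ae_of_all _ fun y => ?_)
    rw [Real.norm_eq_abs, abs_mul, abs_of_nonneg (h0 _)]
    exact (mul_le_of_le_one_right (h0 _) (hf1 _)).trans (hC _)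
  -- Summing over `i` cancels the denominator of `R`; by exchangeability all terms on either side
  -- are equal, so one term on the left equals one on the right.
  have hsum : ∑ i : Fin (N + 1), ∫ y, H (y i) * R y ∂P =
      ∑ i : Fin (N + 1), ∫ y, H (y i) * f (y i) ∂P := by
    rw [← integral_finsetSum _ fun i _ => hint i, ← integral_finsetSum _ fun i _ => hfi i]
    refine integral_congr_ae (ae_of_all _ fun y => ?_)
    simp only [R, ← Finset.sum_mul]
    by_cases h : ∑ l, H (y l) = 0
    · rw [h, zero_mul]
      symm
      refine Finset.sum_eq_zero fun l _ => ?_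
      rw [(Finset.sum_eq_zero_iff_of_nonneg fun l _ => h0 (y l)).1 h l (Finset.mem_univ l),
        zero_mul]
    · field_simp
  have hev : ∀ i : Fin (N + 1), ∫ y, H (y i) * f (y i) ∂P = ∫ x, H x * f x ∂μ := fun i =>
    integral_pi_eval μ i (hH.mul hf)
  simp only [hswap, hev, Finset.sum_const, nsmul_eq_mul] at hsum
  have hne : ((Finset.univ : Finset (Fin (N + 1))).card : ℝ) ≠ 0 := by
    rw [Finset.card_fin]; positivity
  rw [← mul_left_cancel₀ hne hsum]
  exact integral_congr_ae (ae_of_all _ fun y => (h1 y 0).symm)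

/-- The `N + 1` normalised weights have equal expectations and add up to `1`, or to `0` if all the
weights vanish; hence an inequality. -/
theorem integral_div_sum_le {N : ℕ} (hH : Measurable H) (h0 : ∀ y, 0 ≤ H y) :
    ∫ y, H (y 0) / ∑ l, H (y l) ∂Measure.pi (fun _ : Fin (N + 1) => μ) ≤ 1 / (N + 1) := by
  set P := Measure.pi (fun _ : Fin (N + 1) => μ)
  have hswap : ∀ i, ∫ y, H (y i) / ∑ l, H (y l) ∂P = ∫ y, H (y 0) / ∑ l, H (y l) ∂P := by
    intro i
    rw [← integral_pi_comp_swap μ (fun y => H (y 0) / ∑ l, H (y l)) i]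
    refine integral_congr_ae (ae_of_all _ fun y => ?_)
    simp only [Function.comp, Equiv.swap_apply_left]
    rw [Equiv.sum_comp (Equiv.swap 0 i) fun l => H (y l)]
  have hsnn : ∀ y : Fin (N + 1) → Y, 0 ≤ ∑ l, H (y l) := fun y =>
    Finset.sum_nonneg fun l _ => h0 _
  have hint : ∀ i, Integrable (fun y : Fin (N + 1) → Y => H (y i) / ∑ l, H (y l)) P := by
    intro i
    have hm : Measurable fun y : Fin (N + 1) → Y => H (y i) / ∑ l, H (y l) :=
      Measurable.div (by fun_prop) (by fun_prop)
    refine Integrable.of_bound hm.aestronglyMeasurable 1 (ae_of_all _ fun y => ?_)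
    rw [Real.norm_eq_abs, abs_of_nonneg (div_nonneg (h0 _) (hsnn y))]
    exact div_le_one_of_le₀
      (Finset.single_le_sum (f := fun l => H (y l)) (fun l _ => h0 _) (Finset.mem_univ i))
      (hsnn y)
  have hsum : ∑ i : Fin (N + 1), ∫ y, H (y i) / ∑ l, H (y l) ∂P ≤ 1 := by
    rw [← integral_finsetSum _ fun i _ => hint i]
    have : ∫ _, (1 : ℝ) ∂P = 1 := by simp
    rw [← this]
    refine integral_mono (integrable_finsetSum _ fun i _ => hint i) (integrable_const _)
      fun y => ?_
    simp only [← Finset.sum_div]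
    exact div_self_le_one _
  simp only [hswap, Finset.sum_const, Finset.card_fin, nsmul_eq_mul] at hsum
  rw [le_div_iff₀ (by positivity), mul_comm]
  exact_mod_cast hsum

/-- The error of selection with weights `H` among a fixed reference point and `N` independent
draws. -/
theorem abs_integral_weightedMean_sub_le {α : ℝ} (N : ℕ) (hH : Measurable H) (hf : Measurable f)
    (h0 : ∀ y, 0 ≤ H y) (hZ : 0 < ∫ x, H x ∂μ) (hα : ∀ y, H y ≤ α * ∫ x, H x ∂μ)
    (hf1 : ∀ y, |f y| ≤ 1) (x : Y) :
    |∫ y, weightedMean (Fin.cons (H x) fun l => H (y l) : Fin (N + 1) → ℝ)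
        (Fin.cons (f x) fun l => f (y l)) ∂Measure.pi (fun _ : Fin N => μ) -
      (∫ x, H x * f x ∂μ) / ∫ x, H x ∂μ| ≤ 2 * α / (N + 1) := by
  set Z := ∫ x, H x ∂μ
  have hHi : Integrable H μ := by
    by_contra h
    exact hZ.ne' (integral_undef h)
  have hA : 0 < α * Z := by
    by_contra h
    have : Z ≤ 0 := integral_nonpos fun y => (hα y).trans (not_lt.1 h)
    linarith
  set Q := Measure.pi (fun _ : Fin N => μ)
  set W : Y → (Fin N → Y) → ℝ := fun x y =>
    weightedMean (Fin.cons (H x) fun l => H (y l) : Fin (N + 1) → ℝ)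
        (Fin.cons (f x) fun l => f (y l))
  have hcons : ∀ (φ : Y → ℝ) (x : Y) (y : Fin N → Y),
      (fun l => φ ((Fin.cons x y : Fin (N + 1) → Y) l)) =
        (Fin.cons (φ x) fun l => φ (y l) : Fin (N + 1) → ℝ) := by
    intro φ x y
    funext l
    refine Fin.cases ?_ (fun i => ?_) l <;> simp
  have hWm : Measurable fun p : Y × (Fin N → Y) => W p.1 p.2 := by
    simp only [W, ← hcons]
    have : Measurable fun p : Y × (Fin N → Y) => (Fin.cons p.1 p.2 : Fin (N + 1) → Y) := by
      refine measurable_pi_iff.2 fun l => ?_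
      refine Fin.cases ?_ (fun i => ?_) l
      · simpa using measurable_fst
      · simp only [Fin.cons_succ]; fun_prop
    exact measurable_weightedMean (by fun_prop) (by fun_prop)
  have hW1 : ∀ x y, |W x y| ≤ 1 := by
    intro x y
    simp only [W, ← hcons]
    exact abs_weightedMean_le (fun l => h0 _) fun l => hf1 _
  have hWx : Measurable (W x) := hWm.comp measurable_prodMk_left
  -- Both terms are written over the same draws and an extra point `p.1` with density `H`: in `e1`
  -- the reference stays at `x`, in `e2` it is `p.1` and selection is exact.
  have e1 : Z * ∫ y, W x y ∂Q = ∫ p : Y × (Fin N → Y), H p.1 * W x p.2 ∂μ.prod Q :=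
    (integral_prod_mul _ _).symm
  have e2 : ∫ x, H x * f x ∂μ = ∫ p : Y × (Fin N → Y), H p.1 * W p.1 p.2 ∂μ.prod Q := by
    rw [← integral_mul_weightedMean (N := N) hH hf h0 hα hf1, integral_pi_cons]
    simp only [hcons, Fin.cons_zero, W, Q]
  have e3 : ∫ p : Y × (Fin N → Y), H p.1 / (H p.1 + ∑ l, H (p.2 l)) ∂μ.prod Q ≤
      1 / (N + 1) := by
    refine le_of_eq_of_le ?_ (integral_div_sum_le (μ := μ) (N := N) hH h0)
    rw [integral_pi_cons]
    simp only [Fin.sum_univ_succ, Fin.cons_zero, Fin.cons_succ, Q]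
  have hb : ∀ g : Y × (Fin N → Y) → ℝ, Measurable g → (∀ p, |g p| ≤ 1) →
      Integrable (fun p : Y × (Fin N → Y) => H p.1 * g p) (μ.prod Q) := by
    intro g hg hg1
    refine Integrable.of_bound (by fun_prop) (α * Z) (ae_of_all _ fun p => ?_)
    rw [Real.norm_eq_abs, abs_mul, abs_of_nonneg (h0 _)]
    exact (mul_le_of_le_one_right (h0 _) (hg1 _)).trans (hα _)
  have i1 := hb (fun p => W x p.2) (by fun_prop) fun p => hW1 _ _
  have i2 := hb (fun p => W p.1 p.2) hWm fun p => hW1 _ _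
  have hsn : ∀ y : Fin N → Y, 0 ≤ ∑ l, H (y l) := fun y => Finset.sum_nonneg fun l _ => h0 _
  have i3 : Integrable (fun p : Y × (Fin N → Y) => H p.1 / (H p.1 + ∑ l, H (p.2 l)))
      (μ.prod Q) := by
    have hm : Measurable fun p : Y × (Fin N → Y) => H p.1 / (H p.1 + ∑ l, H (p.2 l)) :=
      Measurable.div (by fun_prop) (by fun_prop)
    refine Integrable.of_bound hm.aestronglyMeasurable 1 (ae_of_all _ fun p => ?_)
    have := hsn p.2
    rw [Real.norm_eq_abs, abs_of_nonneg (div_nonneg (h0 _) (add_nonneg (h0 _) this))]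
    exact div_le_one_of_le₀ (by linarith) (add_nonneg (h0 _) this)
  have key : |Z * ∫ y, W x y ∂Q - ∫ x, H x * f x ∂μ| ≤ 2 * (α * Z) * (1 / (N + 1)) := by
    rw [e1, e2, ← integral_sub i1 i2]
    refine abs_integral_le_integral_abs.trans ?_
    refine le_trans ?_ (mul_le_mul_of_nonneg_left e3 (by positivity))
    rw [← integral_const_mul]
    refine integral_mono (i1.sub i2).abs (i3.const_mul _) fun p => ?_
    have h := abs_weightedMean_cons_sub_le (v := fun l => H (p.2 l)) (F := fun l => f (p.2 l))
      hA (fun l => h0 _) (fun l => hf1 _) (h0 x) (hα x) (h0 p.1) (hα p.1) (hf1 x) (hf1 p.1)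
    have hs := hsn p.2
    simp only [← mul_sub, abs_mul, abs_of_nonneg (h0 p.1)]
    -- For `H p.1 > 0` the denominator `A + ∑ H` may be lowered to the positive `H p.1 + ∑ H`, which
    -- turns the bound into the normalised weight of `e3`.
    rcases (h0 p.1).eq_or_lt with h00 | h00
    · rw [← h00]; simp
    · refine (mul_le_mul_of_nonneg_left h h00.le).trans ?_
      rw [mul_div_assoc', mul_div_assoc', mul_comm (H p.1)]
      refine div_le_div_of_nonneg_left (by positivity) (by positivity) ?_
      linarith [hα p.1]
  have : (∫ y, W x y ∂Q) - (∫ x, H x * f x ∂μ) / Z =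
      (Z * ∫ y, W x y ∂Q - ∫ x, H x * f x ∂μ) / Z := by
    field_simp
  change |(∫ y, W x y ∂Q) - (∫ x, H x * f x ∂μ) / Z| ≤ _
  rw [this, abs_div, abs_of_pos hZ, div_le_iff₀ hZ]
  refine key.trans (le_of_eq ?_)
  ring

end Selection

end CSMC

namespace CSMC

/-! ### Genealogies and one step of the particle system -/

theorem lineage_snoc_castSucc {N n : ℕ} (A : Fin n → Fin N → Fin (N + 1))
    (a : Fin N → Fin (N + 1)) (i : Fin (N + 1)) (k : Fin (n + 1)) :
    lineage (Fin.snoc A a : Fin (n + 1) → Fin N → Fin (N + 1)) i k.castSucc =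
      lineage A ((Fin.cons 0 a : Fin (N + 1) → Fin (N + 1)) i) k := by
  induction k using Fin.reverseInduction with
  | last =>
    unfold lineage
    rw [Fin.reverseInduction_castSucc, Fin.reverseInduction_last, Fin.succ_last,
      Fin.reverseInduction_last, Fin.snoc_last]
  | cast k ih =>
    unfold lineage at ih ⊢
    rw [Fin.reverseInduction_castSucc, Fin.reverseInduction_castSucc, ← ih,
      Fin.snoc_castSucc, Fin.succ_castSucc]

theorem points_extend_castSucc {X : Type*} {N n : ℕ} (xbar : Fin (n + 2) → X) (h : History X N n)
    (s : (Fin N → Fin (N + 1)) × (Fin N → X)) (k : Fin (n + 1)) :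
    points xbar (extend h s) k.castSucc = points (Fin.init xbar) h k := by
  simp only [points, extend, Fin.snoc_castSucc]
  rfl

theorem points_extend_last {X : Type*} {N n : ℕ} (xbar : Fin (n + 2) → X) (h : History X N n)
    (s : (Fin N → Fin (N + 1)) × (Fin N → X)) :
    points xbar (extend h s) (Fin.last (n + 1)) = Fin.cons (xbar (Fin.last _)) s.2 := by
  simp only [points, extend, Fin.snoc_last]

/-- The recursion behind the induction on time: a path ending at label `i` is the path of its
ancestor with one point appended. The prefixed `0` makes the reference its own ancestor. -/
theorem outputPath_extend {X : Type*} {N n : ℕ} (xbar : Fin (n + 2) → X) (h : History X N n)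
    (s : (Fin N → Fin (N + 1)) × (Fin N → X)) (i : Fin (N + 1)) :
    outputPath xbar (extend h s) i =
      Fin.snoc (outputPath (Fin.init xbar) h ((Fin.cons 0 s.1 : Fin (N + 1) → Fin (N + 1)) i))
        ((Fin.cons (xbar (Fin.last _)) s.2 : Fin (N + 1) → X) i) := by
  funext k
  refine Fin.lastCases ?_ (fun k => ?_) k
  · simp only [outputPath, Fin.snoc_last, points_extend_last, lineage,
      Fin.reverseInduction_last]
  · simp only [outputPath, Fin.snoc_castSucc, points_extend_castSucc]
    congr 1
    exact lineage_snoc_castSucc _ _ _ _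

theorem integral_selectMeasure {X : Type*} (N : ℕ) (g : X → ℝ≥0) (y : Fin (N + 1) → X)
    (F : Fin (N + 1) → ℝ) :
    ∫ j, F j ∂selectMeasure N g y = weightedMean (fun l => (g (y l) : ℝ)) F := by
  have hcast : ∑ l, (g (y l) : ℝ) = ((∑ l, g (y l) : ℝ≥0) : ℝ) := by push_cast; rfl
  unfold selectMeasure weightedMean
  rw [hcast]
  by_cases h : ∑ l, g (y l) = 0
  · rw [if_pos h, if_pos (by rw [h]; rfl), integral_dirac]
  · rw [if_neg h, if_neg (by exact_mod_cast h),
      integral_finsetSum_measure fun j _ => (integrable_dirac (by simp)).smul_measure (by simp),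
      Finset.sum_div]
    refine Finset.sum_congr rfl fun j _ => ?_
    rw [integral_smul_measure, integral_dirac]
    simp only [ENNReal.coe_toReal, smul_eq_mul, NNReal.coe_div]
    ring

variable {X : Type*} [MeasurableSpace X]

namespace Model

variable (M : Model X)

/-- The joint law of the ancestor label and of the position of one new particle. -/
noncomputable def offspring (N k : ℕ) : Kernel (Fin (N + 1) → X) (Fin (N + 1) × X) :=
  M.select N k ⊗ₖ M.q.comap (fun p : (Fin (N + 1) → X) × Fin (N + 1) => p.1 p.2)
    (measurable_from_prod_countable_left fun j => measurable_pi_apply j)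

instance (N k : ℕ) : IsMarkovKernel (M.offspring N k) := by unfold offspring; infer_instance

/-- The new particles and their ancestor labels are independent and identically distributed. -/
theorem map_step (N k : ℕ) (y : Fin (N + 1) → X) :
    (M.step N k y).map (MeasurableEquiv.arrowProdEquivProdArrow (Fin (N + 1)) X (Fin N)).symm =
      Measure.pi fun _ : Fin N => M.offspring N k y := by
  symm
  refine Measure.pi_eq fun s hs => ?_
  rw [Measure.map_apply (MeasurableEquiv.measurable _) (MeasurableSet.univ_pi hs), step,
    Kernel.compProd_apply ((MeasurableEquiv.measurable _) (MeasurableSet.univ_pi hs)),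
    lintegral_fintype]
  have h1 : ∀ A : Fin N → Fin (N + 1), M.propagate N (y, A) (Prod.mk A ⁻¹'
      ((MeasurableEquiv.arrowProdEquivProdArrow (Fin (N + 1)) X (Fin N)).symm ⁻¹'
        Set.univ.pi s)) = ∏ i, M.q (y (A i)) (Prod.mk (A i) ⁻¹' s i) := by
    intro A
    change Measure.pi (fun i => M.q (y (A i))) _ = _
    rw [← Measure.pi_pi]
    rfl
  have h2 : ∀ A : Fin N → Fin (N + 1), piKernel (fun _ : Fin N => M.select N k) y {A} =
      ∏ i, M.select N k y {A i} := by
    intro A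
    change Measure.pi (fun _ : Fin N => M.select N k y) {A} = _
    rw [Measure.pi_singleton]
  simp only [h1, h2, ← Finset.prod_mul_distrib]
  have h3 : ∀ i, M.offspring N k y (s i) =
      ∑ a, M.q (y a) (Prod.mk a ⁻¹' s i) * M.select N k y {a} := by
    intro i
    rw [offspring, Kernel.compProd_apply (hs i), lintegral_fintype]
    rfl
  -- On a box, the product over particles of sums over labels expands into the sum over all label
  -- vectors.
  simp only [h3, Finset.prod_univ_sum, Fintype.piFinset_univ]

theorem integral_offspring {N k : ℕ} (y : Fin (N + 1) → X) {φ : Fin (N + 1) × X → ℝ} {C : ℝ}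
    (hφ : Measurable φ) (hC : ∀ p, |φ p| ≤ C) :
    ∫ p, φ p ∂M.offspring N k y =
      weightedMean (fun l => (M.G k (y l) : ℝ)) fun l => ∫ x, φ (l, x) ∂M.q (y l) := by
  rw [offspring, integral_compProd
    (Integrable.of_bound hφ.aestronglyMeasurable C (ae_of_all _ hC))]
  exact integral_selectMeasure N (M.G k) y _

theorem integral_step (N k : ℕ) (y : Fin (N + 1) → X) (φ : (Fin N → Fin (N + 1) × X) → ℝ) :
    ∫ s, φ (fun i => (s.1 i, s.2 i)) ∂M.step N k y =
      ∫ s, φ s ∂Measure.pi fun _ : Fin N => M.offspring N k y := by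
  rw [← M.map_step, integral_map_equiv]
  rfl

variable {M}

/-- The error of one step, given the past: selecting at time `k + 1` with weights `H` amounts, up
to this error, to selecting at time `k` with weights `G_k · q H`. -/
theorem abs_integral_step_sub_le {N k : ℕ} {α C : ℝ} {H : X → ℝ} {φ : Fin (N + 1) × X → ℝ}
    (hH : Measurable H) (hφ : Measurable φ) (h0 : ∀ x, 0 ≤ H x) (hC : ∀ x, H x ≤ C)
    (hpos : ∀ x, 0 < ∫ x', H x' ∂M.q x) (hα : ∀ x x', H x' ≤ α * ∫ x', H x' ∂M.q x)
    (hφ1 : ∀ p, |φ p| ≤ 1) (y : Fin (N + 1) → X) (x : X) :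
    |∫ s, weightedMean (fun l => H ((Fin.cons x s.2 : Fin (N + 1) → X) l))
        (fun l => φ ((Fin.cons 0 s.1 : Fin (N + 1) → Fin (N + 1)) l,
          (Fin.cons x s.2 : Fin (N + 1) → X) l)) ∂M.step N k y -
      weightedMean (fun l => M.G k (y l) * ∫ x', H x' ∂M.q (y l))
        (fun l => (∫ x', H x' * φ (l, x') ∂M.q (y l)) / ∫ x', H x' ∂M.q (y l))| ≤
      2 * α / (N + 1) := by
  have hG0 : ∀ l, (0 : ℝ) ≤ M.G k (y l) := fun l => NNReal.coe_nonneg _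
  have hHC : ∀ p : Fin (N + 1) × X, |H p.2| ≤ C := fun p => by
    rw [abs_of_nonneg (h0 _)]; exact hC _
  have hHφC : ∀ p : Fin (N + 1) × X, |H p.2 * φ p| ≤ C := fun p => by
    rw [abs_mul, abs_of_nonneg (h0 _)]
    exact (mul_le_of_le_one_right (h0 _) (hφ1 _)).trans (hC _)
  have eZ := M.integral_offspring (k := k) y (φ := fun p => H p.2) (by fun_prop) hHC
  have eF := M.integral_offspring (k := k) y (φ := fun p => H p.2 * φ p) (by fun_prop) hHφC
  simp only at eZ eF
  have hs : ∑ l, (M.G k (y l) : ℝ) ≠ 0 → 0 < ∑ l, (M.G k (y l) : ℝ) := fun h =>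
    lt_of_le_of_ne (Finset.sum_nonneg fun l _ => hG0 l) (Ne.symm h)
  have hsH : ∑ l, (M.G k (y l) : ℝ) ≠ 0 →
      0 < ∑ l, M.G k (y l) * ∫ x', H x' ∂M.q (y l) := by
    intro h
    obtain ⟨i, hi, hne⟩ := Finset.exists_ne_zero_of_sum_ne_zero h
    exact Finset.sum_pos' (fun l _ => mul_nonneg (hG0 l) (hpos _).le)
      ⟨i, hi, mul_pos (lt_of_le_of_ne (hG0 i) (Ne.symm hne)) (hpos _)⟩
  have hZ : 0 < ∫ p : Fin (N + 1) × X, H p.2 ∂M.offspring N k y := by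
    rw [eZ, weightedMean]
    split_ifs with h
    · exact hpos _
    · exact div_pos (hsH h) (hs h)
  -- The mean of `H` under the offspring law is a weighted mean of its means under the `q (· | y
  -- l)`, so the uniform bound by `α` passes to it.
  have hαZ : ∀ p : Fin (N + 1) × X,
      H p.2 ≤ α * ∫ p : Fin (N + 1) × X, H p.2 ∂M.offspring N k y := by
    intro p
    rw [eZ, weightedMean]
    split_ifs with h
    · exact hα _ _
    · rw [mul_div_assoc', le_div_iff₀ (hs h), mul_comm, Finset.sum_mul, Finset.mul_sum]
      refine Finset.sum_le_sum fun l _ => ?_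
      rw [mul_left_comm α]
      exact mul_le_mul_of_nonneg_left (hα _ _) (hG0 l)
  -- The static estimate on pairs (label, position); the reference pair is `(0, x)`.
  have key := abs_integral_weightedMean_sub_le (μ := M.offspring N k y) (H := fun p => H p.2)
    (f := φ) N (by fun_prop) hφ (fun p => h0 _) hZ hαZ hφ1 (0, x)
  rw [← M.integral_step] at key
  refine le_of_eq_of_le ?_ key
  congr 2
  · refine integral_congr_ae (ae_of_all _ fun s => ?_)
    refine congrArg₂ weightedMean (funext fun l => ?_) (funext fun l => ?_) <;>
      refine Fin.cases ?_ (fun i => ?_) l <;> simp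
  · rw [eZ, eF]
    unfold weightedMean
    by_cases h : ∑ l, (M.G k (y l) : ℝ) = 0
    -- If all the `G_k` weights vanish, so do the weights `G_k · q H`, and the means on both sides
    -- default to label `0`.
    · have h' : ∀ l, (M.G k (y l) : ℝ) = 0 := fun l =>
        (Finset.sum_eq_zero_iff_of_nonneg fun l _ => hG0 l).1 h l (Finset.mem_univ l)
      simp [h']
    · rw [if_neg h, if_neg h, if_neg (hsH h).ne', div_div_div_cancel_right₀ h]
      congr 1
      refine Finset.sum_congr rfl fun l _ => ?_
      have := (hpos (y l)).ne'
      field_simp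

end Model

end CSMC

namespace CSMC

/-! ### Backward induction on the terminal time -/

theorem outputPath_last {X : Type*} {N n : ℕ} (xbar : Fin (n + 1) → X) (h : History X N n)
    (i : Fin (N + 1)) :
    outputPath xbar h i (Fin.last n) = points xbar h (Fin.last n) i := by
  simp only [outputPath, lineage, Fin.reverseInduction_last]

variable {X : Type*} [MeasurableSpace X]

namespace Model

variable (M : Model X)

/-- The expectation of `f` at the output of the conditional particle system up to time `n`, when
the final label is drawn with weights `H`. -/
noncomputable def terminalMean (N n : ℕ) (H : X → ℝ) (f : (Fin (n + 1) → X) → ℝ)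
    (xbar : Fin (n + 1) → X) : ℝ :=
  ∫ h, weightedMean (fun l => H (points xbar h (Fin.last n) l))
    (fun l => f (outputPath xbar h l)) ∂M.particles N n xbar

/-- The expectation of `G_0 (X_0) ⋯ G_{n-1} (X_{n-1}) H (X_n) f (X_0, …, X_n)` under the law of
the Markov chain. -/
noncomputable def chainMean (n : ℕ) (H : X → ℝ) (f : (Fin (n + 1) → X) → ℝ) : ℝ :=
  ∫ x, (∏ i : Fin n, (M.G i (x i.castSucc) : ℝ)) * H (x (Fin.last n)) * f x ∂M.pathLaw n

theorem measurable_chain {n : ℕ} {H : X → ℝ} {f : (Fin (n + 1) → X) → ℝ} (hH : Measurable H)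
    (hf : Measurable f) : Measurable fun x : Fin (n + 1) → X =>
      (∏ i : Fin n, (M.G i (x i.castSucc) : ℝ)) * H (x (Fin.last n)) * f x := by
  have hG : ∀ i : Fin n, Measurable fun x : Fin (n + 1) → X => (M.G i (x i.castSucc) : ℝ) :=
    fun i => ((M.measurable_G i).comp (measurable_pi_apply _)).coe_nnreal_real
  fun_prop

theorem measurable_terminal {N n : ℕ} {H : X → ℝ} {f : (Fin (n + 1) → X) → ℝ}
    (hH : Measurable H) (hf : Measurable f) (xbar : Fin (n + 1) → X) :
    Measurable fun h : History X N n =>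
      weightedMean (fun l => H (points xbar h (Fin.last n) l))
        (fun l => f (outputPath xbar h l)) := by
  refine measurable_weightedMean (measurable_pi_iff.2 fun l => ?_)
    (measurable_pi_iff.2 fun l => ?_)
  · exact hH.comp ((measurable_pi_apply l).comp
      ((measurable_points (Fin.last n)).comp measurable_prodMk_left))
  · exact hf.comp (measurable_outputPath.comp
      (measurable_prodMk_left.comp measurable_prodMk_right))

theorem integral_csmc (N n : ℕ) {f : (Fin (n + 1) → X) → ℝ} (hf : Measurable f)
    (hf1 : ∀ x, |f x| ≤ 1) (xbar : Fin (n + 1) → X) :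
    ∫ x, f x ∂M.csmc N n xbar = M.terminalMean N n (fun x => M.G n x) f xbar := by
  have hm : Measurable fun p : History X N n × Fin (N + 1) => f (outputPath xbar p.1 p.2) :=
    hf.comp (measurable_outputPath.comp measurable_prodMk_left)
  rw [csmc, Kernel.map_apply _ measurable_outputPath,
    integral_map measurable_outputPath.aemeasurable hf.aestronglyMeasurable, Kernel.prod_apply,
    Kernel.id_apply, Measure.dirac_prod,
    integral_map (f := fun p : (Fin (n + 1) → X) × (History X N n × Fin (N + 1)) =>
      f (outputPath p.1 p.2.1 p.2.2)) measurable_prodMk_left.aemeasurable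
      (hf.comp measurable_outputPath).aestronglyMeasurable,
    integral_compProd (Integrable.of_bound hm.aestronglyMeasurable 1
      (ae_of_all _ fun _ => hf1 _))]
  refine integral_congr_ae (ae_of_all _ fun h => ?_)
  exact integral_selectMeasure N (M.G n) _ _

/-- The kernel that runs one step of the particle system from a given history. -/
noncomputable def stepFrom (N n : ℕ) (xbar : Fin (n + 1) → X) :
    Kernel (History X N n) ((Fin N → Fin (N + 1)) × (Fin N → X)) :=
  (M.step N n).comap (fun h => points xbar h (Fin.last n))
    ((measurable_points (Fin.last n)).comp measurable_prodMk_left)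

instance (N n : ℕ) (xbar : Fin (n + 1) → X) : IsMarkovKernel (M.stepFrom N n xbar) := by
  unfold stepFrom; infer_instance

theorem terminalMean_succ (N n : ℕ) {H : X → ℝ} {f : (Fin (n + 2) → X) → ℝ}
    (hH : Measurable H) (hf : Measurable f) (h0 : ∀ x, 0 ≤ H x) (hf1 : ∀ x, |f x| ≤ 1)
    (xbar : Fin (n + 2) → X) :
    M.terminalMean N (n + 1) H f xbar =
      ∫ h, ∫ s, weightedMean (fun l => H (points xbar (extend h s) (Fin.last (n + 1)) l))
        (fun l => f (outputPath xbar (extend h s) l)) ∂M.stepFrom N n (Fin.init xbar) h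
        ∂M.particles N n (Fin.init xbar) := by
  have hm := measurable_terminal (N := N) hH hf xbar
  rw [terminalMean, particles, Kernel.map_apply _ measurable_extend,
    integral_map measurable_extend.aemeasurable hm.aestronglyMeasurable,
    integral_compProd (f := fun p : History X N n × ((Fin N → Fin (N + 1)) × (Fin N → X)) =>
      weightedMean (fun l => H (points xbar (extend p.1 p.2) (Fin.last (n + 1)) l))
        (fun l => f (outputPath xbar (extend p.1 p.2) l)))
      (Integrable.of_bound (hm.comp measurable_extend).aestronglyMeasurable 1
      (ae_of_all _ fun _ => abs_weightedMean_le (fun _ => h0 _) fun _ => hf1 _))]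
  rfl

/-- Nonnegative functions `H_0, …, H_n` with `H_k = G_k · q H_{k+1}` that are at most `α` times
their own means. -/
structure IsBackward (M : Model X) (n : ℕ) (α : ℝ) (H : ℕ → X → ℝ) : Prop where
  measurable : ∀ k, Measurable (H k)
  nonneg : ∀ k x, 0 ≤ H k x
  eq_mul_integral : ∀ k < n, ∀ x, H k x = M.G k x * ∫ x', H (k + 1) x' ∂M.q x
  integral_pos : ∀ k < n, ∀ x, 0 < ∫ x', H (k + 1) x' ∂M.q x
  le_mul_integral : ∀ k < n, ∀ x x', H (k + 1) x' ≤ α * ∫ x', H (k + 1) x' ∂M.q x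

/-- The mean of `f (x_0, …, x_k, x')` under the law of `x'` with density `H` with respect to
`q (· | x_k)`. -/
noncomputable def twistedMean {k : ℕ} (H : X → ℝ) (f : (Fin (k + 2) → X) → ℝ)
    (x : Fin (k + 1) → X) : ℝ :=
  (∫ x', H x' * f (Fin.snoc x x') ∂M.q (x (Fin.last k))) / ∫ x', H x' ∂M.q (x (Fin.last k))

theorem measurable_twistedMean {k : ℕ} {H : X → ℝ} {f : (Fin (k + 2) → X) → ℝ}
    (hH : Measurable H) (hf : Measurable f) : Measurable (M.twistedMean H f) := by
  have h1 : Measurable fun p : (Fin (k + 1) → X) × X => H p.2 * f (Fin.snoc p.1 p.2) :=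
    (hH.comp measurable_snd).mul (hf.comp measurable_snoc)
  have h2 := (StronglyMeasurable.integral_kernel_prod_right'
    (κ := M.q.comap (fun x : Fin (k + 1) → X => x (Fin.last k)) (measurable_pi_apply _))
    h1.stronglyMeasurable).measurable
  have h3 := (StronglyMeasurable.integral_kernel (κ := M.q) hH.stronglyMeasurable).measurable
  exact h2.div (h3.comp (measurable_pi_apply (Fin.last k)))

theorem abs_integral_mul_le {μ : Measure X} {H φ : X → ℝ} (hH : Integrable H μ)
    (h0 : ∀ x, 0 ≤ H x) (hφ : ∀ x, |φ x| ≤ 1) : |∫ x, H x * φ x ∂μ| ≤ ∫ x, H x ∂μ :=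
  norm_integral_le_of_norm_le (f := fun x => H x * φ x) hH (ae_of_all _ fun x => by
    rw [Real.norm_eq_abs, abs_mul, abs_of_nonneg (h0 x)]
    exact mul_le_of_le_one_right (h0 x) (hφ x))

namespace IsBackward

variable {M} {n : ℕ} {α : ℝ} {H : ℕ → X → ℝ} (hB : M.IsBackward n α H)
include hB

theorem integrable {k : ℕ} (hk : k < n) (x : X) : Integrable (H (k + 1)) (M.q x) := by
  -- The integral of a nonintegrable function is `0` by convention, so positivity forces
  -- integrability.
  by_contra h
  exact (hB.integral_pos k hk x).ne' (integral_undef h)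

theorem abs_twistedMean_le {k : ℕ} (hk : k < n) {f : (Fin (k + 2) → X) → ℝ}
    (hf1 : ∀ x, |f x| ≤ 1) (x : Fin (k + 1) → X) : |M.twistedMean (H (k + 1)) f x| ≤ 1 := by
  have hp := hB.integral_pos k hk (x (Fin.last k))
  rw [twistedMean, abs_div, abs_of_pos hp, div_le_one hp]
  exact abs_integral_mul_le (hB.integrable hk _) (hB.nonneg _) fun _ => hf1 _

/-- One step back in time does not change the unnormalised expectation. -/
theorem chainMean_succ {k : ℕ} (hk : k < n) {a : ℝ} (ha : ∀ i < n, ∀ x, (M.G i x : ℝ) ≤ a)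
    {f : (Fin (k + 2) → X) → ℝ} (hf : Measurable f) (hf1 : ∀ x, |f x| ≤ 1) :
    M.chainMean (k + 1) (H (k + 1)) f =
      M.chainMean k (H k) (M.twistedMean (H (k + 1)) f) := by
  have hm := M.measurable_chain (hB.measurable (k + 1)) hf
  obtain ⟨x₀⟩ : Nonempty X := nonempty_of_isProbabilityMeasure M.m₀
  have ha0 : 0 ≤ a := (NNReal.coe_nonneg _).trans (ha k hk x₀)
  set C := α * ∫ x', H (k + 1) x' ∂M.q x₀
  rw [chainMean, pathLaw, integral_map measurable_snoc.aemeasurable hm.aestronglyMeasurable,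
    Measure.integral_compProd]
  · refine integral_congr_ae (ae_of_all _ fun x => ?_)
    simp only [Fin.snoc_castSucc, Fin.snoc_last, mul_assoc, Kernel.comap_apply]
    rw [integral_const_mul, Fin.prod_univ_castSucc, twistedMean, hB.eq_mul_integral k hk]
    have := (hB.integral_pos k hk (x (Fin.last k))).ne'
    simp only [Fin.val_castSucc, Fin.val_last]
    field_simp
  · refine Integrable.of_bound (hm.comp measurable_snoc).aestronglyMeasurable (a ^ (k + 1) * C)
      (ae_of_all _ fun p => ?_)
    have h1 : ∏ i : Fin (k + 1),
        (M.G i ((Fin.snoc p.1 p.2 : Fin (k + 2) → X) i.castSucc) : ℝ) ≤ a ^ (k + 1) := by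
      refine (Finset.prod_le_prod (g := fun _ => a) (fun i _ => NNReal.coe_nonneg _)
        fun (i : Fin (k + 1)) _ => ha i (lt_of_le_of_lt (Nat.lt_succ_iff.1 i.2) hk) _).trans (le_of_eq ?_)
      simp
    have h2 : (0 : ℝ) ≤ ∏ i : Fin (k + 1),
        (M.G i ((Fin.snoc p.1 p.2 : Fin (k + 2) → X) i.castSucc) : ℝ) :=
      Finset.prod_nonneg fun i _ => NNReal.coe_nonneg _
    rw [Real.norm_eq_abs, abs_mul, abs_mul, abs_of_nonneg h2,
      abs_of_nonneg (hB.nonneg _ _)]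
    exact (mul_le_of_le_one_right (mul_nonneg h2 (hB.nonneg _ _)) (hf1 _)).trans
      (mul_le_mul h1 (hB.le_mul_integral k hk _ _) (hB.nonneg _ _) (by positivity))

/-- The twisted mean of `1` is `1`, so the total mass is the same at all times; at `k = n` this
identifies the normalising constant with the mean of `H_0`. -/
theorem chainMean_one {a : ℝ} (ha : ∀ i < n, ∀ x, (M.G i x : ℝ) ≤ a) {k : ℕ} (hk : k ≤ n) :
    M.chainMean k (H k) (fun _ => 1) = ∫ x, H 0 x ∂M.m₀ := by
  induction k with
  | zero =>
    rw [chainMean, pathLaw, integral_map (by fun_prop)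
      (M.measurable_chain (hB.measurable 0) measurable_const).aestronglyMeasurable]
    simp
  | succ k ih =>
    rw [hB.chainMean_succ hk ha measurable_const (by simp), ← ih (by omega)]
    congr 1
    funext x
    rw [twistedMean]
    simp [(hB.integral_pos k hk _).ne']

/-- The error of the conditional particle system up to time `k` with final weights `H_k`. -/
theorem abs_terminalMean_sub_le (hpos : 0 < ∫ x, H 0 x ∂M.m₀)
    (hα : ∀ x, H 0 x ≤ α * ∫ x, H 0 x ∂M.m₀) {a : ℝ} (ha : ∀ i < n, ∀ x, (M.G i x : ℝ) ≤ a) (N : ℕ) {k : ℕ}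
    (hk : k ≤ n) {f : (Fin (k + 1) → X) → ℝ} (hf : Measurable f) (hf1 : ∀ x, |f x| ≤ 1)
    (xbar : Fin (k + 1) → X) :
    |M.terminalMean N k (H k) f xbar - M.chainMean k (H k) f / ∫ x, H 0 x ∂M.m₀| ≤
      2 * (k + 1) * α / (N + 1) := by
  induction k with
  | zero =>
    have hHm := hB.measurable 0
    have e1 : M.chainMean 0 (H 0) f = ∫ x, H 0 x * f (fun _ => x) ∂M.m₀ := by
      rw [chainMean, pathLaw, integral_map (by fun_prop)
        (M.measurable_chain hHm hf).aestronglyMeasurable]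
      simp
    have e2 : M.terminalMean N 0 (H 0) f xbar =
        ∫ y, weightedMean (Fin.cons (H 0 (xbar 0)) fun l => H 0 (y l) : Fin (N + 1) → ℝ)
          (Fin.cons (f fun _ => xbar 0) fun l => f fun _ => y l)
          ∂Measure.pi (fun _ : Fin N => M.m₀) := by
      rw [terminalMean, particles, Kernel.const_apply, integral_map (by fun_prop)
        (measurable_terminal hHm hf xbar).aestronglyMeasurable]
      refine integral_congr_ae (ae_of_all _ fun y => ?_)
      have hl : ∀ l : Fin (N + 1), outputPath xbar ((fun _ => y, Fin.elim0) : History X N 0) l =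
          fun _ => (Fin.cons (xbar 0) y : Fin (N + 1) → X) l := by
        intro l
        funext k
        obtain rfl : k = Fin.last 0 := Fin.fin_one_eq_zero k
        rw [outputPath_last]
        rfl
      refine congrArg₂ weightedMean (funext fun l => ?_) (funext fun l => ?_)
      · refine Fin.cases ?_ (fun i => ?_) l <;> simp [points]
      · rw [hl]
        refine Fin.cases ?_ (fun i => ?_) l <;> simp
    rw [e1, e2]
    have key := abs_integral_weightedMean_sub_le (μ := M.m₀) (H := H 0)
      (f := fun x => f fun _ => x) N hHm (by fun_prop) (hB.nonneg 0) hpos hα (fun _ => hf1 _) (xbar 0)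
    simpa using key
  | succ k ih =>
    have hHm := hB.measurable (k + 1)
    obtain ⟨x₀⟩ : Nonempty X := ⟨xbar 0⟩
    have hFm := M.measurable_twistedMean hHm hf
    have hF1 := hB.abs_twistedMean_le hk hf1
    have ih' := ih (by omega) hFm hF1 (Fin.init xbar)
    rw [← hB.chainMean_succ hk ha hf hf1] at ih'
    rw [M.terminalMean_succ N k hHm hf (hB.nonneg _) hf1]
    have hm : Measurable fun p : History X N k × ((Fin N → Fin (N + 1)) × (Fin N → X)) =>
        weightedMean (fun l => H (k + 1) (points xbar (extend p.1 p.2) (Fin.last (k + 1)) l))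
        (fun l => f (outputPath xbar (extend p.1 p.2) l)) :=
      (measurable_terminal hHm hf xbar).comp measurable_extend
    have i1 : Integrable (fun h => ∫ s,
        weightedMean (fun l => H (k + 1) (points xbar (extend h s) (Fin.last (k + 1)) l))
        (fun l => f (outputPath xbar (extend h s) l)) ∂M.stepFrom N k (Fin.init xbar) h)
        (M.particles N k (Fin.init xbar)) := by
      refine Integrable.of_bound (StronglyMeasurable.integral_kernel_prod_right'
        hm.stronglyMeasurable).aestronglyMeasurable 1 (ae_of_all _ fun h => ?_)
      refine (norm_integral_le_of_norm_le_const (C := 1) (ae_of_all _ fun s => ?_)).trans ?_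
      · exact abs_weightedMean_le (fun _ => hB.nonneg _ _) fun _ => hf1 _
      · simp
    have i2 : Integrable (fun h => weightedMean
        (fun l => H k (points (Fin.init xbar) h (Fin.last k) l))
        (fun l => M.twistedMean (H (k + 1)) f (outputPath (Fin.init xbar) h l)))
        (M.particles N k (Fin.init xbar)) :=
      Integrable.of_bound
        (measurable_terminal (hB.measurable k) hFm (Fin.init xbar)).aestronglyMeasurable 1
        (ae_of_all _ fun h => abs_weightedMean_le (fun _ => hB.nonneg _ _) fun _ => hF1 _)
    have hstep : |(∫ h, ∫ s,
        weightedMean (fun l => H (k + 1) (points xbar (extend h s) (Fin.last (k + 1)) l))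
        (fun l => f (outputPath xbar (extend h s) l)) ∂M.stepFrom N k (Fin.init xbar) h
        ∂M.particles N k (Fin.init xbar)) -
        M.terminalMean N k (H k) (M.twistedMean (H (k + 1)) f) (Fin.init xbar)| ≤
        2 * α / (N + 1) := by
      rw [terminalMean, ← integral_sub i1 i2, ← Real.norm_eq_abs]
      refine (norm_integral_le_of_norm_le_const (C := 2 * α / (N + 1))
        (ae_of_all _ fun h => ?_)).trans ?_
      swap
      · simp
      rw [Real.norm_eq_abs]
      have hφ : Measurable fun p : Fin (N + 1) × X =>
          f (Fin.snoc (outputPath (Fin.init xbar) h p.1) p.2) :=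
        measurable_from_prod_countable_right fun l =>
          hf.comp (measurable_snoc.comp
            (measurable_prodMk_left (x := outputPath (Fin.init xbar) h l)))
      -- With the history frozen, `f` of an output path depends only on the pair (ancestor label,
      -- new position), which is how `φ` is chosen.
      have key := abs_integral_step_sub_le (k := k) hHm hφ (hB.nonneg _)
        (hB.le_mul_integral k hk x₀) (hB.integral_pos k hk) (hB.le_mul_integral k hk)
        (fun _ => hf1 _) (points (Fin.init xbar) h (Fin.last k)) (xbar (Fin.last (k + 1)))
      simp only [outputPath_extend, points_extend_last, twistedMean, outputPath_last,
        hB.eq_mul_integral k hk]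
      exact key
    have := (abs_sub_le _ _ _).trans (add_le_add hstep ih')
    refine this.trans (le_of_eq ?_)
    push_cast
    ring

end IsBackward

end Model

end CSMC

namespace CSMC

variable {X : Type*} [MeasurableSpace X]

namespace Model

variable (M : Model X)

/-! ### Target distribution, observation likelihoods and the constant `α` -/

theorem measurable_weight (n : ℕ) : Measurable (M.weight n) :=
  Finset.measurable_prod _ fun i _ =>
    ((M.measurable_G i).comp (measurable_pi_apply i)).coe_nnreal_ennreal

theorem weight_lt_top (n : ℕ) (x : Fin (n + 1) → X) : M.weight n x < ⊤ :=
  ENNReal.prod_lt_top fun _ _ => ENNReal.coe_lt_top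

theorem toReal_weight (n : ℕ) (x : Fin (n + 1) → X) :
    (M.weight n x).toReal =
      (∏ i : Fin n, (M.G i (x i.castSucc) : ℝ)) * M.G n (x (Fin.last n)) := by
  rw [weight, ENNReal.toReal_prod, Fin.prod_univ_castSucc]
  simp

theorem toReal_normConst (n : ℕ) :
    (M.normConst n).toReal = M.chainMean n (fun x => M.G n x) fun _ => 1 := by
  rw [normConst, ← integral_toReal (M.measurable_weight n).aemeasurable
    (ae_of_all _ (M.weight_lt_top n)), chainMean]
  simp only [toReal_weight, mul_one]

theorem integral_target (n : ℕ) (f : (Fin (n + 1) → X) → ℝ) :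
    ∫ x, f x ∂M.target n = M.chainMean n (fun x => M.G n x) f /
      M.chainMean n (fun x => M.G n x) fun _ => 1 := by
  rw [target, integral_smul_measure, integral_withDensity_eq_integral_toReal_smul
    (M.measurable_weight n) (ae_of_all _ (M.weight_lt_top n)), ENNReal.toReal_inv,
    toReal_normConst]
  simp only [toReal_weight, smul_eq_mul]
  exact inv_mul_eq_div _ _

theorem normConst_ne_top {n : ℕ} {a : ℝ} (ha : M.BoundedPotentials n a) :
    M.normConst n ≠ ⊤ := by
  refine ((lintegral_mono (g := fun _ => ((a.toNNReal : ℝ≥0∞)) ^ (n + 1)) fun x => ?_).trans_lt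
    ?_).ne
  · refine (Finset.prod_le_prod' (g := fun _ => (a.toNNReal : ℝ≥0∞)) fun i _ => ?_).trans_eq
      (by simp)
    exact ENNReal.coe_le_coe.2
      (NNReal.le_toNNReal_of_coe_le (ha i (Nat.lt_succ_iff.1 i.2) _))
  · rw [lintegral_const, measure_univ, mul_one]
    exact ENNReal.pow_lt_top ENNReal.coe_lt_top

theorem futureLik_nonneg (m k : ℕ) (x : X) : 0 ≤ M.futureLik m k x := by
  induction m generalizing k x with
  | zero => exact zero_le_one
  | succ m ih => exact integral_nonneg fun x' => mul_nonneg (NNReal.coe_nonneg _) (ih _ _)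

theorem measurable_futureLik (m k : ℕ) : Measurable (M.futureLik m k) := by
  induction m generalizing k with
  | zero => exact measurable_const
  | succ m ih =>
    exact (StronglyMeasurable.integral_kernel (κ := M.q)
      ((M.measurable_G (k + 1)).coe_nnreal_real.mul (ih (k + 1))).stronglyMeasurable).measurable

theorem obsLik_eq_integral {k n : ℕ} (hk : k < n) (x : X) :
    M.obsLik k n x = ∫ x', (M.G (k + 1) x' : ℝ) * M.obsLik (k + 1) n x' ∂M.q x := by
  obtain ⟨m, rfl⟩ : ∃ m, n = k + 1 + m := ⟨n - (k + 1), by omega⟩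
  have h1 : k + 1 + m - k = m + 1 := by omega
  have h2 : k + 1 + m - (k + 1) = m := by omega
  simp only [obsLik, h1, h2, futureLik]

theorem obsLik_self (n : ℕ) (x : X) : M.obsLik n n x = 1 := by
  simp [obsLik, futureLik]

theorem BoundedPotentials.integrable {M : Model X} {n : ℕ} {a : ℝ}
    (hA2 : M.BoundedPotentials n a) {k : ℕ} (hk : k ≤ n)
    (μ : Measure X) [IsProbabilityMeasure μ] : Integrable (fun x => (M.G k x : ℝ)) μ :=
  Integrable.of_bound (M.measurable_G k).coe_nnreal_real.aestronglyMeasurable a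
    (ae_of_all _ fun x => by
      rw [Real.norm_eq_abs, abs_of_nonneg (NNReal.coe_nonneg _)]; exact hA2 k hk x)

namespace BoundedRatio

variable {M} {n : ℕ} {g a c : ℝ} (hA1 : M.BoundedRatio n g)
include hA1

theorem obsLik_pos {k : ℕ} (hk : k ≤ n) (x : X) : 0 < M.obsLik k n x := by
  rcases hk.eq_or_lt with rfl | hk
  · rw [obsLik_self]; exact zero_lt_one
  · refine lt_of_le_of_ne (M.futureLik_nonneg _ _ _) fun h => ?_
    have := (hA1.2 k hk x x).1
    rw [← h, div_zero] at this
    exact hA1.1.not_ge this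

/-- A ratio with `x = x'` is `1`; `1 ≤ n` supplies the time `k = 0`. This extends the ratio bound to
`k = n`, where the likelihood is `1`. -/
theorem le_one (hn : 1 ≤ n) : g ≤ 1 := by
  obtain ⟨x⟩ : Nonempty X := nonempty_of_isProbabilityMeasure M.m₀
  have := (hA1.2 0 hn x x).1
  rwa [div_self (hA1.obsLik_pos (Nat.zero_le n) x).ne'] at this

theorem mul_obsLik_le (hn : 1 ≤ n) {k : ℕ} (hk : k ≤ n) (x x' : X) :
    g * M.obsLik k n x' ≤ M.obsLik k n x := by
  rcases hk.eq_or_lt with rfl | hk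
  · simpa [obsLik_self] using hA1.le_one hn
  · exact (le_div_iff₀ (hA1.obsLik_pos hk.le x')).1 (hA1.2 k hk x x').1

theorem integrable_mul_obsLik (hA2 : M.BoundedPotentials n a) (hn : 1 ≤ n) {k : ℕ} (hk : k ≤ n)
    (μ : Measure X) [IsProbabilityMeasure μ] :
    Integrable (fun x => (M.G k x : ℝ) * M.obsLik k n x) μ := by
  obtain ⟨x₀⟩ : Nonempty X := nonempty_of_isProbabilityMeasure M.m₀
  have hm := (M.measurable_G k).coe_nnreal_real.mul (M.measurable_futureLik (n - k) k)
  refine Integrable.of_bound hm.aestronglyMeasurable (a * (g⁻¹ * M.obsLik k n x₀))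
    (ae_of_all _ fun x => ?_)
  have h0 := (hA1.obsLik_pos hk x).le
  have hG : (0 : ℝ) ≤ M.G k x := NNReal.coe_nonneg _
  change ‖(M.G k x : ℝ) * M.obsLik k n x‖ ≤ _
  rw [Real.norm_eq_abs, abs_of_nonneg (mul_nonneg hG h0)]
  refine mul_le_mul (hA2 k hk x) ?_ h0 (hG.trans (hA2 k hk x))
  rw [inv_mul_eq_div, le_div_iff₀ hA1.1, mul_comm]
  exact hA1.mul_obsLik_le hn hk x₀ x

theorem integral_mul_le (hA2 : M.BoundedPotentials n a) (hn : 1 ≤ n) {k : ℕ} (hk : k ≤ n)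
    (μ : Measure X) [IsProbabilityMeasure μ] (x' : X) :
    (∫ x, (M.G k x : ℝ) ∂μ) * (g * M.obsLik k n x') ≤
      ∫ x, (M.G k x : ℝ) * M.obsLik k n x ∂μ := by
  rw [← integral_mul_const]
  exact integral_mono ((hA2.integrable hk μ).mul_const _)
    (hA1.integrable_mul_obsLik hA2 hn hk μ) fun x =>
      mul_le_mul_of_nonneg_left (hA1.mul_obsLik_le hn hk x x') (NNReal.coe_nonneg _)

theorem le_integral_mul (hA2 : M.BoundedPotentials n a) (hn : 1 ≤ n) {k : ℕ} (hk : k ≤ n)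
    (μ : Measure X) [IsProbabilityMeasure μ] (x' : X) :
    g * ∫ x, (M.G k x : ℝ) * M.obsLik k n x ∂μ ≤
      (∫ x, (M.G k x : ℝ) ∂μ) * M.obsLik k n x' := by
  rw [← integral_mul_const, ← integral_const_mul]
  refine integral_mono ((hA1.integrable_mul_obsLik hA2 hn hk μ).const_mul _)
    ((hA2.integrable hk μ).mul_const _) fun x => ?_
  change g * ((M.G k x : ℝ) * M.obsLik k n x) ≤ _
  rw [mul_left_comm]
  exact mul_le_mul_of_nonneg_left (hA1.mul_obsLik_le hn hk x' x) (NNReal.coe_nonneg _)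

/-- The source of `α = a c g⁻¹`: `a` bounds the potential, `g⁻¹` is the price of replacing the
likelihood at `x'` by that at any other state, and `c` compensates the mean potential. -/
theorem mul_obsLik_le_integral (hA2 : M.BoundedPotentials n a) (hn : 1 ≤ n) (hc : 0 < c) {k : ℕ}
    (hk : k ≤ n) (μ : Measure X) [IsProbabilityMeasure μ] (hμ : c⁻¹ ≤ ∫ x, (M.G k x : ℝ) ∂μ)
    (x' : X) :
    (M.G k x' : ℝ) * M.obsLik k n x' ≤
      a * c * g⁻¹ * ∫ x, (M.G k x : ℝ) * M.obsLik k n x ∂μ := by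
  have hg := hA1.1
  have ho := hA1.obsLik_pos hk x'
  have ha : 0 ≤ a := (NNReal.coe_nonneg _).trans (hA2 k hk x')
  have h1 := (mul_le_mul_of_nonneg_right hμ (mul_pos hg ho).le).trans
    (hA1.integral_mul_le hA2 hn hk μ x')
  calc (M.G k x' : ℝ) * M.obsLik k n x' ≤ a * M.obsLik k n x' :=
        mul_le_mul_of_nonneg_right (hA2 k hk x') ho.le
    _ = a * c * g⁻¹ * (c⁻¹ * (g * M.obsLik k n x')) := by field_simp
    _ ≤ _ := mul_le_mul_of_nonneg_left h1 (by positivity)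

theorem isBackward (hA2 : M.BoundedPotentials n a) (hn : 1 ≤ n) (hc : 0 < c)
    (hq : ∀ k, 1 ≤ k → k ≤ n → ∀ x, c⁻¹ < ∫ x', (M.G k x' : ℝ) ∂M.q x) :
    M.IsBackward n (a * c * g⁻¹) fun k x => M.G k x * M.obsLik k n x where
  measurable k := (M.measurable_G k).coe_nnreal_real.mul (M.measurable_futureLik (n - k) k)
  nonneg k x := mul_nonneg (NNReal.coe_nonneg _) (M.futureLik_nonneg _ _ _)
  eq_mul_integral k hk x := by rw [M.obsLik_eq_integral hk]
  integral_pos k hk x := by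
    rw [← M.obsLik_eq_integral hk]
    exact hA1.obsLik_pos hk.le x
  le_mul_integral k hk x x' :=
    hA1.mul_obsLik_le_integral hA2 hn hc hk _ (hq (k + 1) (by omega) hk x).le x'

/-- Up to factors `g`, the mean of `G_{k+1}` under `q (· | x)` is `p_{k+1:n} (x) / p_{k+2:n}`, and
the ratio bound makes this uniform in `x`. This gives the lower bound `e k`, evaluated at one state
`x₀`. -/
theorem exists_lt_integral_kernel (hA2 : M.BoundedPotentials n a) (hn : 1 ≤ n) {ε : ℝ}
    (hε : 0 < ε) :
    ∃ c, 0 < c ∧ c⁻¹ < ε ∧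
      ∀ k, 1 ≤ k → k ≤ n → ∀ x, c⁻¹ < ∫ x', (M.G k x' : ℝ) ∂M.q x := by
  obtain ⟨x₀⟩ : Nonempty X := nonempty_of_isProbabilityMeasure M.m₀
  have hg := hA1.1
  set e : ℕ → ℝ := fun k => g * (g * M.obsLik k n x₀) / M.obsLik (k + 1) n x₀
  have he : ∀ k ∈ Finset.range n, 0 < (e k)⁻¹ := by
    intro k hk
    have hk := Finset.mem_range.1 hk
    have h1 := hA1.obsLik_pos hk.le x₀
    have h2 := hA1.obsLik_pos (Nat.succ_le_of_lt hk) x₀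
    positivity
  have hsum : 0 ≤ ∑ k ∈ Finset.range n, (e k)⁻¹ := Finset.sum_nonneg fun k hk => (he k hk).le
  have hε' : 0 < ε⁻¹ := inv_pos.2 hε
  -- The sum dominates each `(e k)⁻¹`; the summand `1` makes the bound by `ε` strict.
  refine ⟨1 + ε⁻¹ + ∑ k ∈ Finset.range n, (e k)⁻¹, by positivity, ?_, ?_⟩
  · exact inv_lt_of_inv_lt₀ hε (by linarith)
  · intro k hk1 hk x
    obtain ⟨k, rfl⟩ : ∃ j, k = j + 1 := ⟨k - 1, by omega⟩
    have hmem : k ∈ Finset.range n := Finset.mem_range.2 hk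
    have h1 : (e k)⁻¹ ≤ ∑ k ∈ Finset.range n, (e k)⁻¹ :=
      Finset.single_le_sum (fun k hk => (he k hk).le) hmem
    refine (inv_lt_of_inv_lt₀ (inv_pos.1 (he k hmem)) (by linarith)).trans_le ?_
    rw [div_le_iff₀ (hA1.obsLik_pos hk x₀)]
    refine le_trans ?_ (hA1.le_integral_mul hA2 hn hk (M.q x) x₀)
    rw [← M.obsLik_eq_integral hk]
    exact mul_le_mul_of_nonneg_left (hA1.mul_obsLik_le hn (by omega) x x₀) hg.le

theorem integral_G_zero_pos (hA2 : M.BoundedPotentials n a) (hn : 1 ≤ n)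
    (hπ : M.normConst n ≠ 0) : 0 < ∫ x, (M.G 0 x : ℝ) ∂M.m₀ := by
  obtain ⟨x₀⟩ : Nonempty X := nonempty_of_isProbabilityMeasure M.m₀
  -- Only the bounds for the kernel are needed here, so the value of `ε` is immaterial.
  obtain ⟨c, hc, -, hq⟩ := hA1.exists_lt_integral_kernel hA2 hn one_pos
  have hB := hA1.isBackward hA2 hn hc hq
  have h1 := hB.chainMean_one (fun i hi => hA2 i hi.le) le_rfl
  simp only [obsLik_self, mul_one] at h1
  rw [← M.toReal_normConst] at h1
  have h2 : 0 < (M.normConst n).toReal := ENNReal.toReal_pos hπ (M.normConst_ne_top hA2)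
  have h3 := hA1.le_integral_mul hA2 hn (Nat.zero_le n) M.m₀ x₀
  rw [← h1] at h3
  exact pos_of_mul_pos_left ((mul_pos hA1.1 h2).trans_le h3)
    (hA1.obsLik_pos (Nat.zero_le n) x₀).le

theorem abs_integral_csmc_sub_le (hA2 : M.BoundedPotentials n a) (hn : 1 ≤ n)
    (hc : M.PotentialLowerBound n c) (N : ℕ) {f : (Fin (n + 1) → X) → ℝ} (hf : Measurable f)
    (hf1 : ∀ x, |f x| ≤ 1) (xbar : Fin (n + 1) → X) :
    |∫ x, f x ∂M.csmc N n xbar - ∫ x, f x ∂M.target n| ≤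
      2 * (n + 1) * (a * c * g⁻¹) / (N + 1) := by
  obtain ⟨hc0, hm, hq⟩ := hc
  have hB := hA1.isBackward hA2 hn hc0 hq
  have h1 := hB.chainMean_one (fun i hi => hA2 i hi.le) le_rfl
  have hpos : 0 < ∫ x, (M.G 0 x : ℝ) * M.obsLik 0 n x ∂M.m₀ :=
    (mul_pos ((inv_pos.2 hc0).trans hm)
      (mul_pos hA1.1 (hA1.obsLik_pos (Nat.zero_le n) (xbar 0)))).trans_le
      (hA1.integral_mul_le hA2 hn (Nat.zero_le n) M.m₀ (xbar 0))
  have key := hB.abs_terminalMean_sub_le hpos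
    (hA1.mul_obsLik_le_integral hA2 hn hc0 (Nat.zero_le n) M.m₀ hm.le)
    (fun i hi => hA2 i hi.le) N le_rfl hf hf1 xbar
  rw [← h1] at key
  simp only [obsLik_self, mul_one] at key
  rwa [M.integral_csmc N n hf hf1, M.integral_target]

theorem one_le_mul (hA2 : M.BoundedPotentials n a) (hn : 1 ≤ n)
    (hc : M.PotentialLowerBound n c) : 1 ≤ a * c * g⁻¹ := by
  obtain ⟨hc0, hm, -⟩ := hc
  have h1 : ∫ x, (M.G 0 x : ℝ) ∂M.m₀ ≤ a := by
    have := integral_mono (hA2.integrable (Nat.zero_le n) M.m₀) (integrable_const a)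
      (hA2 0 (Nat.zero_le n))
    simpa using this
  have h2 : 1 ≤ a * c := by
    have := mul_le_mul_of_nonneg_right (hm.le.trans h1) hc0.le
    rwa [inv_mul_cancel₀ hc0.ne'] at this
  exact one_le_mul_of_one_le_of_one_le h2 ((one_le_inv₀ hA1.1).2 (hA1.le_one hn))

end BoundedRatio

end Model

/-! ### Comparison of the bounds and conclusion -/

theorem div_add_one_le {n N α : ℝ} (hn : 1 ≤ n) (hN : 1 ≤ N) (hα : 1 ≤ α) :
    2 * (n + 1) * α / (N + 1) ≤ (2 * (n + 1) * α - 1) / (N - 1 + 2 * α) + n * α ^ 2 / N := by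
  have hD : 0 < N - 1 + 2 * α := by linarith
  rw [div_add_div _ _ hD.ne' (by positivity), div_le_div_iff₀ (by positivity) (by positivity)]
  -- Measured from `1`, all three variables are nonnegative, and the cross-multiplied difference is
  -- a polynomial with nonnegative coefficients.
  obtain ⟨m, rfl⟩ : ∃ m, n = 1 + m := ⟨n - 1, by ring⟩
  obtain ⟨b, rfl⟩ : ∃ b, α = 1 + b := ⟨α - 1, by ring⟩
  obtain ⟨K, rfl⟩ : ∃ K, N = 1 + K := ⟨N - 1, by ring⟩
  have hm : 0 ≤ m := by linarith
  have hb : 0 ≤ b := by linarith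
  have hK : 0 ≤ K := by linarith
  rw [← sub_nonneg]
  have e : ((2 * (1 + m + 1) * (1 + b) - 1) * (1 + K) +
      (1 + K - 1 + 2 * (1 + b)) * ((1 + m) * (1 + b) ^ 2)) * (1 + K + 1) -
      2 * (1 + m + 1) * (1 + b) * ((1 + K - 1 + 2 * (1 + b)) * (1 + K)) =
      (2 + K + 4 * b + 2 * b * K + 2 * b * K ^ 2 + 4 * b ^ 2 + b ^ 2 * K ^ 2 + 4 * b ^ 3 +
        2 * b ^ 3 * K) +
      m * (4 + 4 * K + K ^ 2 + 8 * b + 6 * b * K + 2 * b * K ^ 2 + 8 * b ^ 2 + 4 * b ^ 2 * K +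
        b ^ 2 * K ^ 2 + 4 * b ^ 3 + 2 * b ^ 3 * K) := by ring
  rw [e]
  positivity

theorem add_le_mul_div {n N α : ℝ} (hn : 1 ≤ n) (hN : 1 ≤ N) (hα : 1 ≤ α) :
    (2 * (n + 1) * α - 1) / (N - 1 + 2 * α) + n * α ^ 2 / N ≤ (4 * α + α ^ 2) * (n / N) := by
  -- Here `n + 1 ≤ 2 n` handles the numerator and `2 α ≥ 1` the denominator.
  have h1 : (2 * (n + 1) * α - 1) / (N - 1 + 2 * α) ≤ 4 * α * n / N :=
    div_le_div₀ (by positivity) (by nlinarith) (by positivity) (by linarith)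
  calc _ ≤ 4 * α * n / N + n * α ^ 2 / N := add_le_add_left h1 _
    _ = _ := by ring

end CSMC

theorem theorem2 {X : Type*} [MeasurableSpace X] (M : CSMC.Model X) (n : ℕ) (hn : 1 ≤ n)
    (hπ : M.normConst n ≠ 0) (a g : ℝ)
    (hA1 : M.BoundedRatio n g) (hA2 : M.BoundedPotentials n a) :
    (∃ c, M.PotentialLowerBound n c) ∧
    ∀ c, M.PotentialLowerBound n c →
      ∀ N : ℕ, 1 ≤ N → ∀ f : (Fin (n + 1) → X) → ℝ, Measurable f → (∀ x, |f x| ≤ 1) →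
        ∀ xbar : Fin (n + 1) → X,
          |∫ x, f x ∂M.csmc N n xbar - ∫ x, f x ∂M.target n| ≤
            (2 * (n + 1) * a * c * g⁻¹ - 1) / (N - 1 + 2 * a * c * g⁻¹) +
              n * (a * c * g⁻¹) ^ 2 / N ∧
          |∫ x, f x ∂M.csmc N n xbar - ∫ x, f x ∂M.target n| ≤
            (4 * (a * c * g⁻¹) + (a * c * g⁻¹) ^ 2) * (n / N) := by
  refine ⟨?_, fun c hc N hN f hf hf1 xbar => ?_⟩
  · obtain ⟨c, hc, h0, hq⟩ := hA1.exists_lt_integral_kernel hA2 hn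
      (hA1.integral_G_zero_pos hA2 hn hπ)
    exact ⟨c, hc, h0, hq⟩
  · have hn' : (1 : ℝ) ≤ n := by exact_mod_cast hn
    have hN' : (1 : ℝ) ≤ N := by exact_mod_cast hN
    have hα := hA1.one_le_mul hA2 hn hc
    have h1 := (hA1.abs_integral_csmc_sub_le hA2 hn hc N hf hf1 xbar).trans
      (CSMC.div_add_one_le hn' hN' hα)
    have e : (2 * (n + 1) * a * c * g⁻¹ - 1) / (N - 1 + 2 * a * c * g⁻¹) =
        (2 * (n + 1) * (a * c * g⁻¹) - 1) / (N - 1 + 2 * (a * c * g⁻¹)) := by ring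
    rw [e]
    exact ⟨h1, h1.trans (CSMC.add_le_mul_div hn' hN' hα)⟩
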